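/- Let $\overline{\mathbb D}=\{z\in\mathbb C:|z|\le 1\}$ be the closed unit disk. A Leja sequence for $\overline{\mathbb D}$ is a sequence $(\eta_k)_{k\ge1}$ of points of $\overline{\mathbb D}$ such that $|\eta_1|=1$ and, for all $k\ge2$, $$\sup_{z\in\overline{\mathbb D}}\prod_{j=1}^{k-1}|z-\eta_j|=\prod_{j=1}^{k-1}|\eta_k-\eta_j| .$$ (The points of such a sequence are pairwise distinct.) For $N\ge1$, the Lebesgue constant of its $N$-section $(\eta_1,\dots,\eta_N)$ is $$\Lambda_N=\sup_{z\in\overline{\mathbb D}}\ \sum_{k=1}^N\bigl|l_k^{(N)}(z)\bigr|,\qquad l_k^{(N)}(z)=\prod_{j=1,\,j\ne k}^N\frac{z-\eta_j}{\eta_k-\eta_j}.$$ Then, for every Leja sequence for $\overline{\mathbb D}$ and every $N\ge1$, $$\Lambda_N\le\pi\exp(3\pi)\,N .$$ In particular $\Lambda_N=O(N)$ as $N\to\infty$. -/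

import Mathlib

open Polynomial

/-- A Leja sequence for a compact set `K ⊆ ℂ`, numbered from `0` (so `η 0, η 1, …` are the points
usually written `η₁, η₂, …`): its points lie in `K`, the first one lies on the boundary of `K`, and
each further point `η k` realizes the supremum over `z ∈ K` of the product of the distances
from `z` to the preceding points `η 0, …, η (k - 1)`. -/
structure IsLejaSequence (K : Set ℂ) (η : ℕ → ℂ) : Prop where
  mem : ∀ k, η k ∈ K
  first_mem_frontier : η 0 ∈ frontier K
  isLUB : ∀ k, 1 ≤ k →
    IsLUB ((fun z : ℂ => ∏ j ∈ Finset.range k, ‖z - η j‖) '' K)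
      (∏ j ∈ Finset.range k, ‖η k - η j‖)

/-- The fundamental Lagrange interpolation polynomial attached to the node `η k` among the first
`N` points `η 0, …, η (N - 1)` of a sequence. -/
noncomputable def lagrangeFund (η : ℕ → ℂ) (N k : ℕ) : ℂ[X] :=
  Lagrange.basis (Finset.range N) η k

theorem lagrangeFund_eval (η : ℕ → ℂ) (N k : ℕ) (z : ℂ) :
    (lagrangeFund η N k).eval z = ∏ j ∈ (Finset.range N).erase k, (z - η j) / (η k - η j) := by
  simp only [lagrangeFund, Lagrange.basis, Lagrange.basisDivisor, eval_prod, eval_mul, eval_C,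
    eval_sub, eval_X]
  exact Finset.prod_congr rfl fun j _ => by rw [div_eq_inv_mul]

/-- The Lebesgue constant, relative to a compact set `K`, of the first `N` points of `η`: the
supremum over `z ∈ K` of the sum of the absolute values at `z` of the `N` fundamental Lagrange
interpolation polynomials. -/
noncomputable def lebesgueConstant (K : Set ℂ) (η : ℕ → ℂ) (N : ℕ) : ℝ :=
  sSup ((fun z : ℂ => ∑ k ∈ Finset.range N, ‖(lagrangeFund η N k).eval z‖) '' K)

/-- The supremum that defines the Lebesgue constant is attained, so it is a true supremum. -/
theorem isGreatest_lebesgueConstant {K : Set ℂ} (hK : IsCompact K) (hne : K.Nonempty)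
    (η : ℕ → ℂ) (N : ℕ) :
    IsGreatest ((fun z : ℂ => ∑ k ∈ Finset.range N, ‖(lagrangeFund η N k).eval z‖) '' K)
      (lebesgueConstant K η N) :=
  (hK.image (continuous_finsetSum _ fun k _ =>
    (lagrangeFund η N k).continuous.norm)).isGreatest_sSup (hne.image _)

/-! Every fundamental polynomial is bounded by 13 on the disk, uniformly in `N`; summing gives `13 *
N`, and `13 ≤ π exp(3π)`. The points form antipodal pairs whose squares are again a Leja sequence,
so `z ↦ z ^ 2` halves `N` and permits strong induction (`IsLejaSequence.exists_control`). A plain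
bound would lose a factor at each halving. The induction instead carries an `r` tied to the
distances from `z` to the node and to the next point `η N`; its weight `1 - ‖z - η m‖` absorbs the
loss. The triangle inequality turns this control into the bound 13. -/

theorem IsLejaSequence.norm_le_one {η : ℕ → ℂ}
    (hη : IsLejaSequence (Metric.closedBall (0 : ℂ) 1) η) (k : ℕ) : ‖η k‖ ≤ 1 := by
  simpa using hη.mem k

theorem IsLejaSequence.prod_le {η : ℕ → ℂ}
    (hη : IsLejaSequence (Metric.closedBall (0 : ℂ) 1) η) (k : ℕ) {z : ℂ} (hz : ‖z‖ ≤ 1) :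
    ∏ j ∈ Finset.range k, ‖z - η j‖ ≤ ∏ j ∈ Finset.range k, ‖η k - η j‖ := by
  rcases Nat.eq_zero_or_pos k with rfl | hk
  · simp
  · exact (hη.isLUB k hk).1 ⟨z, by simpa using hz, rfl⟩

theorem IsLejaSequence.prod_pos {η : ℕ → ℂ}
    (hη : IsLejaSequence (Metric.closedBall (0 : ℂ) 1) η) (k : ℕ) :
    0 < ∏ j ∈ Finset.range k, ‖η k - η j‖ := by
  have hinf : (Metric.closedBall (0 : ℂ) 1).Infinite :=
    infinite_of_mem_nhds 0 (Metric.closedBall_mem_nhds 0 one_pos)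
  obtain ⟨z, hz, hzn⟩ := hinf.exists_notMem_finset ((Finset.range k).image η)
  refine lt_of_lt_of_le (Finset.prod_pos fun j hj => ?_) (hη.prod_le k (by simpa using hz))
  rw [norm_pos_iff, sub_ne_zero]
  rintro rfl
  exact hzn (Finset.mem_image_of_mem _ hj)

/-- By the maximum principle, the points of a Leja sequence for the closed unit disk lie on the
unit circle. -/
theorem IsLejaSequence.norm_eq_one {η : ℕ → ℂ}
    (hη : IsLejaSequence (Metric.closedBall (0 : ℂ) 1) η) (k : ℕ) : ‖η k‖ = 1 := by
  have h0 : ‖η 0‖ = 1 := by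
    have h := hη.first_mem_frontier
    rw [frontier_closedBall _ one_ne_zero] at h
    simpa using h
  rcases Nat.eq_zero_or_pos k with rfl | hk
  · exact h0
  refine (hη.norm_le_one k).antisymm (not_lt.1 fun hlt => ?_)
  have hd : Differentiable ℂ fun z : ℂ => ∏ j ∈ Finset.range k, (z - η j) := by fun_prop
  have hmax : IsMaxOn (norm ∘ fun z : ℂ => ∏ j ∈ Finset.range k, (z - η j))
      (Metric.ball (0 : ℂ) 1) (η k) := fun z hz => by
    simp only [Set.mem_ofPred_eq, Function.comp, norm_prod]
    exact hη.prod_le k (by simpa using (Metric.mem_ball.1 hz).le)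
  -- An interior maximum makes the modulus constant up to the boundary, where it vanishes at `η 0`.
  have h := Complex.norm_eqOn_closure_of_isPreconnected_of_isMaxOn
    (convex_ball (0 : ℂ) 1).isPreconnected Metric.isOpen_ball hd.diffContOnCl
    (by simpa using hlt) hmax
    (show η 0 ∈ closure (Metric.ball (0 : ℂ) 1) by
      rw [closure_ball _ one_ne_zero]; exact hη.mem 0)
  have hpos := hη.prod_pos k
  simp only [Function.comp, Function.const_apply, norm_prod] at h
  rw [Finset.prod_eq_zero (Finset.mem_range.2 hk) (by simp)] at h
  exact hpos.ne h

/-! ### Antipodal pairs and squaring -/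

theorem prod_range_two_mul {M : Type*} [CommMonoid M] (f : ℕ → M) (k : ℕ) :
    ∏ j ∈ Finset.range (2 * k), f j = ∏ j ∈ Finset.range k, (f (2 * j) * f (2 * j + 1)) := by
  induction k with
  | zero => simp
  | succ k ih =>
    rw [show 2 * (k + 1) = 2 * k + 1 + 1 by ring, Finset.prod_range_succ, Finset.prod_range_succ,
      ih, Finset.prod_range_succ, mul_assoc]

theorem prod_norm_sub_of_antipodal {η : ℕ → ℂ} {k : ℕ}
    (h : ∀ j < k, η (2 * j + 1) = -η (2 * j)) (z : ℂ) :
    ∏ j ∈ Finset.range (2 * k), ‖z - η j‖ = ∏ j ∈ Finset.range k, ‖z ^ 2 - η (2 * j) ^ 2‖ := by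
  rw [prod_range_two_mul]
  refine Finset.prod_congr rfl fun j hj => ?_
  rw [h j (Finset.mem_range.1 hj), ← norm_mul]
  congr 1
  ring

theorem eq_neg_of_two_le_norm_sub {z e : ℂ} (hz : ‖z‖ ≤ 1) (he : ‖e‖ ≤ 1) (h : 2 ≤ ‖z - e‖) :
    z = -e := by
  have hp := parallelogram_law_with_norm ℝ z e
  have h0 : ‖z + e‖ = 0 := by
    nlinarith [norm_nonneg (z + e), norm_nonneg z, norm_nonneg e]
  exact eq_neg_of_add_eq_zero_left (norm_eq_zero.1 h0)

/-- The points of a Leja sequence for the closed unit disk come in antipodal pairs. -/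
theorem IsLejaSequence.antipodal {η : ℕ → ℂ}
    (hη : IsLejaSequence (Metric.closedBall (0 : ℂ) 1) η) (k : ℕ) :
    η (2 * k + 1) = -η (2 * k) := by
  induction k using Nat.strong_induction_on with
  | _ k ih =>
    refine eq_neg_of_two_le_norm_sub (hη.norm_le_one _) (hη.norm_le_one _) ?_
    have h1 := hη.prod_le (2 * k + 1) (z := -η (2 * k)) (by simpa using hη.norm_le_one _)
    have h2 := hη.prod_le (2 * k) (hη.norm_le_one (2 * k + 1))
    have h3 := hη.prod_pos (2 * k)
    have h4 : ‖-η (2 * k) - η (2 * k)‖ = 2 := by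
      rw [show -η (2 * k) - η (2 * k) = -(2 * η (2 * k)) by ring, norm_neg, norm_mul,
        hη.norm_eq_one]
      norm_num
    -- The product over the earlier pairs is even in `z`, so testing at `-η (2 * k)` forces a
    -- distance of at least 2.
    rw [Finset.prod_range_succ, Finset.prod_range_succ, h4, prod_norm_sub_of_antipodal ih,
      neg_sq, ← prod_norm_sub_of_antipodal ih] at h1
    by_contra! h5
    nlinarith [norm_nonneg (η (2 * k + 1) - η (2 * k))]

/-- The squares of the points of even index of a Leja sequence for the closed unit disk form a
Leja sequence. -/
theorem IsLejaSequence.sq {η : ℕ → ℂ}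
    (hη : IsLejaSequence (Metric.closedBall (0 : ℂ) 1) η) :
    IsLejaSequence (Metric.closedBall (0 : ℂ) 1) fun j => η (2 * j) ^ 2 where
  mem k := by simp [hη.norm_eq_one]
  first_mem_frontier := by
    rw [frontier_closedBall _ one_ne_zero]
    simp [hη.norm_eq_one]
  isLUB k _ := by
    refine IsGreatest.isLUB ⟨⟨η (2 * k) ^ 2, by simp [hη.norm_eq_one], rfl⟩, ?_⟩
    rintro _ ⟨w, hw, rfl⟩
    obtain ⟨z, rfl⟩ := IsAlgClosed.exists_pow_nat_eq w two_pos
    have hz : ‖z‖ ≤ 1 := by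
      have : ‖z‖ ^ 2 ≤ 1 := by simpa using hw
      nlinarith [norm_nonneg z]
    have h := hη.prod_le (2 * k) hz
    rwa [prod_norm_sub_of_antipodal fun j _ => hη.antipodal j,
      prod_norm_sub_of_antipodal fun j _ => hη.antipodal j] at h

/-- The value at `z` of the fundamental Lagrange polynomial of the node `η m`, as a product over
all indices. -/
theorem lagrangeFund_eval_eq_prod_ite (η : ℕ → ℂ) (N m : ℕ) (z : ℂ) :
    (lagrangeFund η N m).eval z =
      ∏ j ∈ Finset.range N, if j = m then 1 else (z - η j) / (η m - η j) := by
  rw [lagrangeFund_eval, Finset.prod_ite, Finset.prod_const_one, one_mul]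
  refine Finset.prod_congr ?_ fun _ _ => rfl
  ext j
  simp [and_comm]

theorem lagrangeFund_eval_succ (η : ℕ → ℂ) {N m : ℕ} (h : m < N) (z : ℂ) :
    (lagrangeFund η (N + 1) m).eval z =
      (lagrangeFund η N m).eval z * ((z - η N) / (η m - η N)) := by
  rw [lagrangeFund_eval_eq_prod_ite, lagrangeFund_eval_eq_prod_ite, Finset.prod_range_succ,
    if_neg h.ne']

theorem lagrangeFund_eval_self (η : ℕ → ℂ) (N : ℕ) (z : ℂ) :
    (lagrangeFund η (N + 1) N).eval z =
      ∏ j ∈ Finset.range N, (z - η j) / (η N - η j) := by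
  rw [lagrangeFund_eval, Finset.range_add_one, Finset.erase_insert Finset.notMem_range_self]

/-- Antipodal factors combine into differences of squares; only the partner `-η m` of the node is
left over, giving the linear factor. -/
theorem lagrangeFund_eval_two_mul {η : ℕ → ℂ} (h : ∀ j, η (2 * j + 1) = -η (2 * j))
    {k i m : ℕ} (hi : i < k) (hm : m = 2 * i ∨ m = 2 * i + 1) (z : ℂ) :
    (lagrangeFund η (2 * k) m).eval z =
      (lagrangeFund (fun j => η (2 * j) ^ 2) k i).eval (z ^ 2) * ((z + η m) / (2 * η m)) := by
  have hsq : η m ^ 2 = η (2 * i) ^ 2 := by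
    rcases hm with rfl | rfl
    · rfl
    · rw [h, neg_sq]
  rw [lagrangeFund_eval_eq_prod_ite, lagrangeFund_eval_eq_prod_ite, prod_range_two_mul]
  have hpair : ∀ j ∈ Finset.range k,
      ((if 2 * j = m then 1 else (z - η (2 * j)) / (η m - η (2 * j))) *
        if 2 * j + 1 = m then 1 else (z - η (2 * j + 1)) / (η m - η (2 * j + 1))) =
      (if j = i then 1 else (z ^ 2 - η (2 * j) ^ 2) / (η (2 * i) ^ 2 - η (2 * j) ^ 2)) *
        if j = i then (z + η m) / (2 * η m) else 1 := by
    intro j _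
    by_cases hj : j = i
    · subst hj
      rcases hm with rfl | rfl
      · rw [if_pos rfl, if_neg (by omega), if_pos rfl, if_pos rfl, h]
        congr 2 <;> ring
      · rw [if_neg (by omega), if_pos rfl, if_pos rfl, if_pos rfl, h, one_mul, mul_one]
        congr 1
        ring
    · rw [if_neg (by omega), if_neg (by omega), if_neg hj, if_neg hj, h, ← hsq, mul_one,
        div_mul_div_comm]
      congr 1 <;> ring
  rw [Finset.prod_congr rfl hpair, Finset.prod_mul_distrib, Finset.prod_ite_eq',
    if_pos (Finset.mem_range.2 hi)]

/-! ### Inductive control and the uniform bound -/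

/-- Both `s` and `p` are at most 2, so `(2 - s) * (2 - p) ≥ 0` bounds `s + p`; expanding then gives
exactly the right side. -/
theorem add_mul_add_le {s p d : ℝ} (hs : 0 ≤ s) (hp : 0 ≤ p) (hd : 0 ≤ d)
    (h : s ^ 2 + p ^ 2 ≤ 4) :
    (p + d) * (s + d) ≤ (1 + d / 2) * (s * p + 2 * d) := by
  have h1 : s + p ≤ 2 + s * p / 2 :=
    abs_le_of_sq_le_sq' (by nlinarith [mul_nonneg hs hp, sq_nonneg (s * p)])
      (by positivity) |>.2
  nlinarith [mul_le_mul_of_nonneg_left h1 hd]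

theorem norm_sq_add_norm_sq_le {z u : ℂ} (hz : ‖z‖ ≤ 1) (hu : ‖u‖ ≤ 1) :
    ‖z - u‖ ^ 2 + ‖z + u‖ ^ 2 ≤ 4 := by
  have hp := parallelogram_law_with_norm ℝ z u
  nlinarith [norm_nonneg z, norm_nonneg u]

/-- How the control of a fundamental Lagrange polynomial propagates under the substitution
`z ↦ z ^ 2`; here `a` is a node and `u` is the point that follows the nodes. -/
theorem control_of_sq {z a u : ℂ} (hz : ‖z‖ ≤ 1) (ha : ‖a‖ = 1) (hu : ‖u‖ ≤ 1) {r q : ℝ}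
    (hr : 0 ≤ r) (hrd : r * ‖z ^ 2 - a ^ 2‖ ≤ 1)
    (hrs : ‖z ^ 2 - a ^ 2‖ ≤ 1 / 2 →
      r * (‖z ^ 2 - u ^ 2‖ + ‖z ^ 2 - a ^ 2‖) ≤ 13 * (1 - ‖z ^ 2 - a ^ 2‖))
    (hq : 0 ≤ q) (hq2 : q ≤ 2) (hqp : q ≤ ‖z + u‖ + ‖z - a‖) :
    r * ‖z + a‖ / 2 * q * ‖z - a‖ ≤ 1 ∧
      (‖z - a‖ ≤ 1 / 2 →
        r * ‖z + a‖ / 2 * q * (‖z - u‖ + ‖z - a‖) ≤ 13 * (1 - ‖z - a‖)) := by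
  have hda : ‖z ^ 2 - a ^ 2‖ = ‖z - a‖ * ‖z + a‖ := by rw [← norm_mul]; congr 1; ring
  have hdu : ‖z ^ 2 - u ^ 2‖ = ‖z - u‖ * ‖z + u‖ := by rw [← norm_mul]; congr 1; ring
  have hsp := norm_sq_add_norm_sq_le hz hu
  have hc2 : ‖z + a‖ ≤ 2 := (norm_add_le _ _).trans (by linarith)
  have hcd : 2 - ‖z - a‖ ≤ ‖z + a‖ := by
    have h := norm_sub_le (z + a) (z - a)
    rw [show z + a - (z - a) = 2 * a by ring, norm_mul, ha, Complex.norm_ofNat] at h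
    linarith
  rw [hda] at hrd hrs
  rw [hdu] at hrs
  have hs0 := norm_nonneg (z - u)
  have hp0 := norm_nonneg (z + u)
  have hd0 := norm_nonneg (z - a)
  have hc0 := norm_nonneg (z + a)
  generalize ‖z - a‖ = d at *
  generalize ‖z + a‖ = c at *
  generalize ‖z - u‖ = s at *
  generalize ‖z + u‖ = p at *
  have hrd0 : 0 ≤ r * (d * c) := by positivity
  refine ⟨by nlinarith, fun hd => ?_⟩
  have hsp0 : 0 ≤ s * p := by positivity
  have key : r * c / 2 * q * (s + d) ≤ (1 + d / 2) * (r * (s * p + d * c)) :=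
    calc r * c / 2 * q * (s + d) = r * c / 2 * (q * (s + d)) := by ring
      _ ≤ r * c / 2 * ((1 + d / 2) * (s * p + 2 * d)) := by
        exact mul_le_mul_of_nonneg_left ((mul_le_mul_of_nonneg_right hqp (by positivity)).trans
          (add_mul_add_le hs0 hp0 hd0 hsp)) (by positivity)
      _ = (1 + d / 2) * (r * (s * p * (c / 2) + d * c)) := by ring
      _ ≤ (1 + d / 2) * (r * (s * p + d * c)) := by
        have h := mul_le_of_le_one_right hsp0 (show c / 2 ≤ 1 by linarith)
        gcongr (1 + d / 2) * (r * (?_ + d * c))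
  refine key.trans ?_
  rcases le_or_gt (d * c) (1 / 2) with h | h
  -- The weight is squared: `1 - d * (2 - d) = (1 - d) ^ 2`, and `(1 + d / 2) * (1 - d) ≤ 1` absorbs
  -- the loss.
  · have h1 := hrs h
    have h2 : d * (2 - d) ≤ d * c := by gcongr
    calc (1 + d / 2) * (r * (s * p + d * c)) ≤ (1 + d / 2) * (13 * (1 - d * (2 - d))) := by
          exact mul_le_mul_of_nonneg_left (h1.trans (by linarith)) (by positivity)
      _ ≤ 13 * (1 - d) := by
          nlinarith [mul_nonneg (mul_nonneg hd0 (show 0 ≤ 1 - d by linarith))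
            (show 0 ≤ 1 + d by linarith)]
  -- This case fixes 13: the left side is at most `5 / 4 * (4 + 1) = 25 / 4`, below `13 / 2 ≤ 13 *
  -- (1 - d)`.
  · have hr2 : r ≤ 2 := by nlinarith
    have hsp2 : s * p ≤ 2 := by nlinarith [sq_nonneg (s - p)]
    have h1 : r * (s * p) ≤ 2 * 2 := by gcongr
    nlinarith

/-- A bound for the fundamental Lagrange polynomials of a Leja sequence, in terms of the distances
from `z` to the node and to the point of the sequence that follows the nodes. -/
theorem IsLejaSequence.exists_control (N : ℕ) : ∀ {η : ℕ → ℂ},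
    IsLejaSequence (Metric.closedBall (0 : ℂ) 1) η → ∀ {m : ℕ}, m < N → ∀ {z : ℂ}, ‖z‖ ≤ 1 →
    ∃ r : ℝ, 0 ≤ r ∧ ‖(lagrangeFund η N m).eval z‖ ≤ r * ‖η m - η N‖ ∧ r * ‖z - η m‖ ≤ 1 ∧
      (‖z - η m‖ ≤ 1 / 2 → r * (‖z - η N‖ + ‖z - η m‖) ≤ 13 * (1 - ‖z - η m‖)) := by
  induction N using Nat.strong_induction_on with
  | _ N ih =>
    intro η hη m hm z hz
    have hle2 : ∀ {x y : ℂ}, ‖x‖ ≤ 1 → ‖y‖ ≤ 1 → ‖x - y‖ ≤ 2 := fun hx hy =>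
      (norm_sub_le _ _).trans (by linarith)
    have hz2 : ‖z ^ 2‖ ≤ 1 := by rw [norm_pow]; exact pow_le_one₀ (norm_nonneg z) hz
    have hsq : ∀ i m, (m = 2 * i ∨ m = 2 * i + 1) → η (2 * i) ^ 2 = η m ^ 2 := by
      rintro i m (rfl | rfl)
      · rfl
      · rw [hη.antipodal, neg_sq]
    have hstep : ∀ k i, i < k → k < N → (m = 2 * i ∨ m = 2 * i + 1) →
        (N = 2 * k ∨ N = 2 * k + 1) → ∃ r : ℝ, 0 ≤ r ∧
          ‖(lagrangeFund η (2 * k) m).eval z‖ ≤ r * ‖z + η m‖ / 2 * ‖η m + η N‖ * ‖η m - η N‖ ∧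
          ∀ q : ℝ, 0 ≤ q → q ≤ 2 → q ≤ ‖z + η N‖ + ‖z - η m‖ →
            r * ‖z + η m‖ / 2 * q * ‖z - η m‖ ≤ 1 ∧
            (‖z - η m‖ ≤ 1 / 2 → r * ‖z + η m‖ / 2 * q * (‖z - η N‖ + ‖z - η m‖) ≤
              13 * (1 - ‖z - η m‖)) := by
      intro k i hi hk hmi hNk
      obtain ⟨r, hr, hl, hrd, hrs⟩ := ih k hk hη.sq hi hz2
      simp only [hsq i m hmi, hsq k N hNk] at hl hrd hrs
      refine ⟨r, hr, ?_, fun q hq hq2 hqp =>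
        control_of_sq hz (hη.norm_eq_one m) (hη.norm_le_one N) hr hrd hrs hq hq2 hqp⟩
      rw [lagrangeFund_eval_two_mul hη.antipodal hi hmi, norm_mul, norm_div, norm_mul,
        hη.norm_eq_one, Complex.norm_ofNat, mul_one]
      calc _ ≤ r * ‖η m ^ 2 - η N ^ 2‖ * (‖z + η m‖ / 2) := by gcongr
        _ = _ := by
          rw [show η m ^ 2 - η N ^ 2 = (η m + η N) * (η m - η N) by ring, norm_mul]
          ring
    obtain ⟨k, hk | hk⟩ := Nat.even_or_odd' N
    · obtain ⟨r, hr, hl, h⟩ := hstep k (m / 2) (by omega) (by omega) (by omega) (.inl hk)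
      refine ⟨r * ‖z + η m‖ / 2 * ‖η m + η N‖, by positivity, hk ▸ hl,
        h _ (norm_nonneg _) ?_ ?_⟩
      · exact (norm_add_le _ _).trans (by linarith [hη.norm_le_one m, hη.norm_le_one N])
      · rw [show η m + η N = z + η N - (z - η m) by ring]
        exact norm_sub_le _ _
    · rcases (show m ≤ 2 * k by omega).eq_or_lt with hmk | hmk
      -- The last node is unpaired: the Leja property bounds its polynomial by 1, and `η N` is at
      -- distance 2.
      · have hN : η N = -η m := by rw [hk, hmk, hη.antipodal]
        have hm1 := hη.norm_eq_one m
        refine ⟨1 / 2, by norm_num, ?_, ?_, fun h => ?_⟩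
        · have h2 : ‖η m - η N‖ = 2 := by
            rw [hN, sub_neg_eq_add, ← two_mul, norm_mul, hm1, Complex.norm_ofNat, mul_one]
          rw [h2, hk, ← hmk, lagrangeFund_eval_self, norm_prod]
          simp only [norm_div]
          rw [Finset.prod_div_distrib, div_le_iff₀ (hη.prod_pos m)]
          linarith [hη.prod_le m hz]
        · linarith [hle2 hz hm1.le]
        · linarith [hle2 hz (hη.norm_le_one N)]
      · obtain ⟨r, hr, hl, h⟩ := hstep k (m / 2) (by omega) (by omega) (by omega) (.inr hk)
        -- The extra node `-η N` contributes a quotient that trades `‖η m + η N‖` for `q = ‖z + η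
        -- N‖`.
        have he : η (2 * k) = -η N := by rw [hk, hη.antipodal, neg_neg]
        refine ⟨r * ‖z + η m‖ / 2 * ‖z + η N‖, by positivity, ?_, h _ (norm_nonneg _) ?_ ?_⟩
        · rw [show lagrangeFund η N m = lagrangeFund η (2 * k + 1) m by rw [hk],
            lagrangeFund_eval_succ η hmk, he, sub_neg_eq_add, sub_neg_eq_add, norm_mul, norm_div]
          calc _ ≤ r * ‖z + η m‖ / 2 * ‖η m + η N‖ * ‖η m - η N‖ *
                (‖z + η N‖ / ‖η m + η N‖) := by gcongr
            _ = r * ‖z + η m‖ / 2 * ‖η m - η N‖ *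
                (‖z + η N‖ / ‖η m + η N‖ * ‖η m + η N‖) := by ring
            _ ≤ r * ‖z + η m‖ / 2 * ‖η m - η N‖ * ‖z + η N‖ := by
              gcongr
              rcases eq_or_ne ‖η m + η N‖ 0 with h0 | h0
              · simp [h0]
              · rw [div_mul_cancel₀ _ h0]
            _ = _ := by ring
        · exact (norm_add_le _ _).trans (by linarith [hη.norm_le_one N])
        · linarith [norm_nonneg (z - η m)]

/-- The fundamental Lagrange polynomials of all sections of a Leja sequence for the closed unit
disk are uniformly bounded on the disk. -/
theorem IsLejaSequence.norm_lagrangeFund_eval_le {η : ℕ → ℂ}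
    (hη : IsLejaSequence (Metric.closedBall (0 : ℂ) 1) η) {N m : ℕ} (hm : m < N) {z : ℂ}
    (hz : ‖z‖ ≤ 1) : ‖(lagrangeFund η N m).eval z‖ ≤ 13 := by
  obtain ⟨r, hr, hl, hrd, hrs⟩ := hη.exists_control N hm hz
  have hd0 := norm_nonneg (z - η m)
  refine hl.trans ?_
  rcases le_or_gt ‖z - η m‖ (1 / 2) with h | h
  · calc r * ‖η m - η N‖ ≤ r * (‖z - η N‖ + ‖z - η m‖) := by
          gcongr
          rw [show η m - η N = z - η N - (z - η m) by ring]
          exact norm_sub_le _ _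
      _ ≤ 13 := by linarith [hrs h]
  · have h2 : ‖η m - η N‖ ≤ 2 :=
      (norm_sub_le _ _).trans (by linarith [hη.norm_le_one m, hη.norm_le_one N])
    have hr2 : r ≤ 2 := by nlinarith
    calc r * ‖η m - η N‖ ≤ 2 * 2 := by gcongr
      _ ≤ 13 := by norm_num

theorem IsLejaSequence.lebesgueConstant_le {η : ℕ → ℂ}
    (hη : IsLejaSequence (Metric.closedBall (0 : ℂ) 1) η) (N : ℕ) :
    lebesgueConstant (Metric.closedBall (0 : ℂ) 1) η N ≤ 13 * N := by
  refine (isGreatest_lebesgueConstant (isCompact_closedBall _ _)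
    ⟨0, by simp⟩ η N).isLUB.2 ?_
  rintro _ ⟨z, hz, rfl⟩
  refine (Finset.sum_le_card_nsmul _ _ 13 fun k hk =>
    hη.norm_lagrangeFund_eval_le (Finset.mem_range.1 hk) (by simpa using hz)).trans ?_
  simp [mul_comm]

theorem thirteen_le_pi_mul_exp : (13 : ℝ) ≤ Real.pi * Real.exp (3 * Real.pi) := by
  have hpi := Real.pi_gt_three
  nlinarith [Real.add_one_le_exp (3 * Real.pi)]

theorem mainTheorem8 (η : ℕ → ℂ) (hη : IsLejaSequence (Metric.closedBall (0 : ℂ) 1) η) :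
    (∀ N : ℕ, 1 ≤ N →
      lebesgueConstant (Metric.closedBall (0 : ℂ) 1) η N
        ≤ Real.pi * Real.exp (3 * Real.pi) * (N : ℝ)) ∧
    Asymptotics.IsBigO Filter.atTop
      (fun N : ℕ => lebesgueConstant (Metric.closedBall (0 : ℂ) 1) η N)
      (fun N : ℕ => (N : ℝ)) := by
  refine ⟨fun N _ => (hη.lebesgueConstant_le N).trans ?_, ?_⟩
  · gcongr
    exact thirteen_le_pi_mul_exp
  · refine Asymptotics.IsBigO.of_bound 13 (Filter.Eventually.of_forall fun N => ?_)
    have h0 : 0 ≤ lebesgueConstant (Metric.closedBall (0 : ℂ) 1) η N :=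
      Real.sSup_nonneg (by
        rintro _ ⟨z, _, rfl⟩
        exact Finset.sum_nonneg fun _ _ => norm_nonneg _)
    rw [Real.norm_of_nonneg h0, Real.norm_of_nonneg N.cast_nonneg]
    exact hη.lebesgueConstant_le N
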